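/- **Definitions.** An *algebraic frame* is a complete lattice $L$ with $a\wedge\bigvee S=\bigvee\{a\wedge s\mid s\in S\}$ for all $a\in L$, $S\subseteq L$, in which every element is a join of compact elements ($k$ is compact if $k\le\bigvee S$ implies $k\le\bigvee T$ for some finite $T\subseteq S$). Let $\mathsf{AlgFrm_J}$ be the category of algebraic frames and maps preserving arbitrary joins and compact elements. Let $X$ be a Priestley space (a compact ordered space in which $x\not\le y$ implies that some clopen upset contains $x$ and misses $y$), and let $X_0\subseteq X$. Let $\mathcal A(X)$ be the set of clopen upsets $U$ with $\max(X\setminus U)\subseteq X_0$, and let $\mathcal I_x=\{U\in\mathcal A(X)\mid x\notin U\}$. A *pointed generalized Priestley space* is a tuple $\langle X,\tau,\le,X_0,m\rangle$ such that $\langle X,\tau,\le\rangle$ is a Priestley space with maximum $m$; $X_0$ is a dense subset of $X\setminus\{m\}$; each $x\ne m$ lies below some $y\in X_0$; $x\in X_0$ iff $\mathcal I_x$ is nonempty and directed under inclusion; and $x\le y$ iff $x\in U\Rightarrow y\in U$ for all $U\in\mathcal A(X)$. For $R\subseteq X\times Y$ and $U\subseteq Y$ put $R[x]=\{y\mid xRy\}$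 and $\Box_RU=\{x\in X\mid R[x]\subseteq U\}$. A *generalized Priestley morphism* $X\to Y$ is a relation $R\subseteq X\times Y$ such that (1) if not $xRy$, then there is $U\in\mathcal A(Y)$ with $R[x]\subseteq U$ and $y\notin U$; (2) $\Box_RU\in\mathcal A(X)$ for each $U\in\mathcal A(Y)$. Let $\mathsf{PGPS}$ be the category of pointed generalized Priestley spaces and generalized Priestley morphisms, where the identity of $X$ is $\le$ and the composite of $R\subseteq X\times Y$ and $S\subseteq Y\times Z$ is given by $x(S*R)z$ iff $x\in\Box_R\Box_SU\Rightarrow z\in U$ for all $U\in\mathcal A(Z)$. The contravariant functor $\mathcal V^a:\mathsf{PGPS}\to\mathsf{AlgFrm_J}$ sends $X$ to the set of closed upsets $C$ of $X$ with $X\setminus C={\downarrow}(X_0\setminus C)$, ordered by $\supseteq$, and sends $R\subseteq X\times Y$ to $\Box_R:\mathcal V^a(Y)\to\mathcal V^a(X)$. In a complete lattice $L$, $a\ll b$ means that $b\le\bigvee S$ implies $a\le\bigvee T$ for some finite $T\subseteq S$. An element $p\ne1$ is *prime* if $a\wedge b\le p$ implies $a\le p$ or $b\le p$, and *pseudoprime*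 if $a_1\wedge\dots\wedge a_n\ll p$ implies $a_i\le p$ for some $i$. The contravariant functor $\mathcal Y:\mathsf{AlgFrm_J}\to\mathsf{PGPS}$ sends $L$ to $\langle Y_L,\tau,\le,P(L),1\rangle$, where $Y_L$ consists of the pseudoprime elements of $L$ together with $1$, $\le$ is the order of $L$, $P(L)$ is the set of prime elements, and $\tau$ is the restriction to $Y_L$ of the topology on $L$ with subbasis $\{{\uparrow}k\}\cup\{L\setminus{\uparrow}k\}$, $k$ compact. It sends $\alpha:L\to M$ with right adjoint $r$ to $R_\alpha\subseteq Y_M\times Y_L$, where $pR_\alpha q$ iff $r(p)\le q$. **Theorem.** The contravariant functors $\mathcal V^a$ and $\mathcal Y$ are well defined and establish a dual equivalence between $\mathsf{AlgFrm_J}$ and $\mathsf{PGPS}$: they are mutually quasi-inverse, i.e. $\mathcal V^a\circ\mathcal Y$ and $\mathcal Y\circ\mathcal V^a$ are naturally isomorphic to the respective identity functors. -/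

import Mathlib

open CategoryTheory

universe u

/-! ### Relations and admissible upsets -/

/-- `boxRel R U = {x | R[x] ⊆ U}`, the modal box of a relation `R ⊆ X × Y`. -/
def boxRel {X Y : Type u} (R : X → Y → Prop) (U : Set Y) : Set X :=
  {x | ∀ y, R x y → y ∈ U}

/-- `𝒜(X)`: the clopen upsets `U` of an ordered space with distinguished subset `X₀` such that
every maximal element of `X ∖ U` lies in `X₀`. -/
def admClopUp {X : Type u} [TopologicalSpace X] [PartialOrder X] (X₀ : Set X) : Set (Set X) :=
  {U | IsClopen U ∧ IsUpperSet U ∧ ∀ x, Maximal (fun y => y ∈ Uᶜ) x → x ∈ X₀}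

/-- `ℐ_x`: the admissible clopen upsets that miss `x`. -/
def admMissing {X : Type u} [TopologicalSpace X] [PartialOrder X] (X₀ : Set X) (x : X) :
    Set (Set X) :=
  {U | U ∈ admClopUp X₀ ∧ x ∉ U}

theorem priestley_isClosed_Ici {X : Type u} [TopologicalSpace X] [PartialOrder X] [PriestleySpace X] (x : X) : IsClosed (Set.Ici x) := by
  rw [← isOpen_compl_iff, isOpen_iff_forall_mem_open]
  intro y hy
  obtain ⟨U, hU, hup, hx, hyU⟩ := exists_isClopen_upper_of_not_le (hy : ¬ x ≤ y)
  exact ⟨Uᶜ, fun z hz hxz => hz (hup hxz hx), hU.compl.isOpen, hyU⟩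

theorem priestley_exists_maximal {X : Type u} [TopologicalSpace X] [PartialOrder X] [PriestleySpace X] [CompactSpace X]
    {K : Set X} (hK : IsClosed K) {x : X} (hx : x ∈ K) :
    ∃ y, x ≤ y ∧ Maximal (fun z => z ∈ K) y := by
  refine zorn_le_nonempty₀ K ?_ x hx
  intro c hc hchain y hy
  have : (⋂ z : c, (Set.Ici z.1 ∩ K)).Nonempty := by
    have : Nonempty c := ⟨⟨y, hy⟩⟩
    refine IsCompact.nonempty_iInter_of_directed_nonempty_isCompact_isClosed _ ?_ ?_ ?_ ?_
    · rintro ⟨a, ha⟩ ⟨b, hb⟩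
      rcases hchain.total ha hb with h | h
      · exact ⟨⟨b, hb⟩, fun w hw => ⟨le_trans h hw.1, hw.2⟩, fun w hw => hw⟩
      · exact ⟨⟨a, ha⟩, fun w hw => hw, fun w hw => ⟨le_trans h hw.1, hw.2⟩⟩
    · exact fun z => ⟨z.1, le_rfl, hc z.2⟩
    · exact fun z => ((priestley_isClosed_Ici z.1).inter hK).isCompact
    · exact fun z => (priestley_isClosed_Ici z.1).inter hK
  obtain ⟨w, hw⟩ := this
  rw [Set.mem_iInter] at hw
  exact ⟨w, (hw ⟨y, hy⟩).2, fun z hz => (hw ⟨z, hz⟩).1⟩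

/-! ### Pointed generalized Priestley spaces -/

/-- A pointed generalized Priestley space `⟨X, τ, ≤, X₀, m⟩`. -/
structure PGPS : Type (u + 1) where
  carrier : Type u
  [topology : TopologicalSpace carrier]
  [order : PartialOrder carrier]
  [compact : CompactSpace carrier]
  [priestley : PriestleySpace carrier]
  /-- the distinguished subset `X₀` -/
  base : Set carrier
  /-- the distinguished point `m` -/
  pt : carrier
  le_pt : ∀ x, x ≤ pt
  base_subset : base ⊆ {pt}ᶜ
  base_dense : {pt}ᶜ ⊆ closure base
  base_order_dense : ∀ x, x ≠ pt → ∃ y ∈ base, x ≤ y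
  mem_base_iff : ∀ x, x ∈ base ↔
    (admMissing base x).Nonempty ∧ DirectedOn (fun U V => U ⊆ V) (admMissing base x)
  le_iff : ∀ x y, x ≤ y ↔ ∀ U ∈ admClopUp base, x ∈ U → y ∈ U

namespace PGPS

instance : CoeSort PGPS.{u} (Type u) := ⟨PGPS.carrier⟩

attribute [instance] PGPS.topology PGPS.order PGPS.compact PGPS.priestley

/-- The admissible clopen upsets `𝒜(X)` of a pointed generalized Priestley space. -/
def adm (X : PGPS.{u}) : Set (Set X) := admClopUp X.base

end PGPS

/-- A generalized Priestley morphism from `X` to `Y`: a relation `R ⊆ X × Y` such that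
`x` not `R`-related to `y` is witnessed by an admissible clopen upset, and `□_R` sends admissible
clopen upsets to admissible clopen upsets. -/
@[ext]
structure GPMor (X Y : PGPS.{u}) : Type u where
  rel : X → Y → Prop
  sep : ∀ x y, ¬ rel x y → ∃ U ∈ Y.adm, (∀ z, rel x z → z ∈ U) ∧ y ∉ U
  box_mem : ∀ U ∈ Y.adm, boxRel rel U ∈ X.adm

/-- The relation `S * R`. -/
def starRel {X Y Z : PGPS.{u}} (R : X → Y → Prop) (S : Y → Z → Prop) (x : X) (z : Z) : Prop :=
  ∀ U ∈ Z.adm, x ∈ boxRel R (boxRel S U) → z ∈ U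

theorem boxRel_le {X : PGPS.{u}} {U : Set X} (hU : IsUpperSet U) :
    boxRel (fun x y : X => x ≤ y) U = U := by
  ext x
  exact ⟨fun h => h x le_rfl, fun h y hy => hU hy h⟩

theorem boxRel_starRel {X Y Z : PGPS.{u}} (R : X → Y → Prop) (S : Y → Z → Prop) {U : Set Z}
    (hU : U ∈ Z.adm) : boxRel (starRel R S) U = boxRel R (boxRel S U) := by
  ext x
  constructor
  · intro h y hy z hz
    exact h z (fun V _ hx => hx y hy z hz)
  · intro h z hz
    exact hz U hU h

theorem GPMor.ext_box {X Y : PGPS.{u}} {R S : GPMor X Y}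
    (h : ∀ U ∈ Y.adm, boxRel R.rel U = boxRel S.rel U) : R = S := by
  ext x y
  constructor
  · intro hR
    by_contra hS
    obtain ⟨U, hU, h1, h2⟩ := S.sep x y hS
    have : x ∈ boxRel R.rel U := by rw [h U hU]; exact h1
    exact h2 (this y hR)
  · intro hS
    by_contra hR
    obtain ⟨U, hU, h1, h2⟩ := R.sep x y hR
    have : x ∈ boxRel S.rel U := by rw [← h U hU]; exact h1
    exact h2 (this y hS)

/-- The identity morphism is the order relation. -/
def GPMor.id (X : PGPS.{u}) : GPMor X X where
  rel x y := x ≤ y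
  sep x y h := by
    rw [X.le_iff] at h
    push Not at h
    obtain ⟨U, hU, hx, hy⟩ := h
    exact ⟨U, hU, fun z hz => hU.2.1 hz hx, hy⟩
  box_mem U hU := by rw [boxRel_le hU.2.1]; exact hU

/-- The composite `S * R` of `R : X → Y` and `S : Y → Z`. -/
def GPMor.comp {X Y Z : PGPS.{u}} (R : GPMor X Y) (S : GPMor Y Z) : GPMor X Z where
  rel := starRel R.rel S.rel
  sep x z h := by
    unfold starRel at h
    push Not at h
    obtain ⟨U, hU, hx, hz⟩ := h
    exact ⟨U, hU, fun w hw => hw U hU hx, hz⟩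
  box_mem U hU := by
    rw [boxRel_starRel _ _ hU]
    exact R.box_mem _ (S.box_mem _ hU)

/-- The category of pointed generalized Priestley spaces and generalized Priestley morphisms. -/
instance PGPS.category : Category.{u} PGPS.{u} where
  Hom := GPMor
  id := GPMor.id
  comp := GPMor.comp
  id_comp {X Y} R := by
    refine GPMor.ext_box fun U hU => ?_
    exact (boxRel_starRel _ _ hU).trans (boxRel_le (R.box_mem U hU).2.1)
  comp_id {X Y} R := by
    refine GPMor.ext_box fun U hU => ?_
    refine (boxRel_starRel _ _ hU).trans ?_
    exact congrArg (boxRel R.rel) (boxRel_le hU.2.1)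
  assoc {W X Y Z} R S T := by
    refine GPMor.ext_box fun U hU => ?_
    refine (boxRel_starRel _ _ hU).trans ?_
    refine (boxRel_starRel _ _ (T.box_mem U hU)).trans ?_
    refine Eq.symm ((boxRel_starRel _ _ hU).trans ?_)
    exact congrArg (boxRel R.rel) (boxRel_starRel _ _ hU)

/-! ### Algebraic frames -/

/-- An algebraic frame: a frame in which every element is a join of compact elements. -/
structure AlgFrmJ : Type (u + 1) where
  carrier : Type u
  [frame : Order.Frame carrier]
  [algebraic : IsCompactlyGenerated carrier]

namespace AlgFrmJ

instance : CoeSort AlgFrmJ.{u} (Type u) := ⟨AlgFrmJ.carrier⟩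

attribute [instance] AlgFrmJ.frame AlgFrmJ.algebraic

end AlgFrmJ

/-- A map between algebraic frames preserving arbitrary joins and compact elements. -/
@[ext]
structure AlgFrmJHom (L M : AlgFrmJ.{u}) : Type u where
  toFun : L → M
  map_sSup : ∀ S : Set L, toFun (sSup S) = sSup (toFun '' S)
  map_compact : ∀ k : L, IsCompactElement k → IsCompactElement (toFun k)

/-- The category of algebraic frames and maps preserving arbitrary joins and compact elements. -/
instance AlgFrmJ.category : Category.{u} AlgFrmJ.{u} where
  Hom := AlgFrmJHom
  id L := ⟨fun a => a, fun S => by simp, fun _ hk => hk⟩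
  comp α β := ⟨fun a => β.toFun (α.toFun a), fun S => by
    rw [α.map_sSup, β.map_sSup, Set.image_image], fun k hk => β.map_compact _ (α.map_compact k hk)⟩

/-! ### Admissible closed upsets -/

/-- An admissible closed upset of `X`: a closed upset `C` with `X ∖ C = ↓(X₀ ∖ C)`. -/
@[ext]
structure AdmClosedUp (X : PGPS.{u}) : Type u where
  carrier : Set X
  closed : IsClosed carrier
  upper : IsUpperSet carrier
  adm : carrierᶜ = {x | ∃ y ∈ X.base \ carrier, x ≤ y}

namespace AdmClosedUp

variable {X : PGPS.{u}}

/-- Admissible closed upsets are ordered by reverse inclusion. -/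
instance : PartialOrder (AdmClosedUp X) where
  le A B := B.carrier ⊆ A.carrier
  le_refl _ := Set.Subset.rfl
  le_trans _ _ _ h₁ h₂ := Set.Subset.trans h₂ h₁
  le_antisymm _ _ h₁ h₂ := AdmClosedUp.ext (Set.Subset.antisymm h₂ h₁)

theorem le_def {A B : AdmClosedUp X} : A ≤ B ↔ B.carrier ⊆ A.carrier := Iff.rfl

theorem exists_base (C : AdmClosedUp X) {x : X} (hx : x ∉ C.carrier) :
    ∃ y ∈ X.base, y ∉ C.carrier ∧ x ≤ y := by
  have h : x ∈ C.carrierᶜ := hx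
  rw [C.adm] at h
  obtain ⟨y, hy, hxy⟩ := h
  exact ⟨y, hy.1, hy.2, hxy⟩

/-- A constructor that only asks for the nontrivial inclusion. -/
def mk₁ (C : Set X) (hc : IsClosed C) (hu : IsUpperSet C)
    (h : ∀ x, x ∉ C → ∃ y ∈ X.base, y ∉ C ∧ x ≤ y) : AdmClosedUp X where
  carrier := C
  closed := hc
  upper := hu
  adm := by
    ext x
    constructor
    · intro hx
      obtain ⟨y, h1, h2, h3⟩ := h x hx
      exact ⟨y, ⟨h1, h2⟩, h3⟩
    · rintro ⟨y, hy, hxy⟩ hx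
      exact hy.2 (hu hxy hx)

/-- Joins are intersections. -/
instance : SupSet (AdmClosedUp X) where
  sSup 𝒮 := mk₁ (⋂ C ∈ 𝒮, C.carrier) (isClosed_biInter fun C _ => C.closed)
    (isUpperSet_iInter₂ fun C _ => C.upper) (by
      intro x hx
      simp only [Set.mem_iInter, not_forall] at hx
      obtain ⟨C, hC, hx⟩ := hx
      obtain ⟨y, h1, h2, h3⟩ := C.exists_base hx
      exact ⟨y, h1, fun h => h2 (Set.mem_iInter₂.1 h C hC), h3⟩)

theorem mem_sSup {𝒮 : Set (AdmClosedUp X)} {x : X} :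
    x ∈ (sSup 𝒮).carrier ↔ ∀ C ∈ 𝒮, x ∈ C.carrier := Set.mem_iInter₂

theorem isLUB_sSup' (𝒮 : Set (AdmClosedUp X)) : IsLUB 𝒮 (sSup 𝒮) :=
  ⟨fun C hC _ hx => mem_sSup.1 hx C hC, fun _ hB _ hx => mem_sSup.2 fun _ hC => hB hC hx⟩

instance : CompleteLattice (AdmClosedUp X) := completeLatticeOfSup _ isLUB_sSup'

end AdmClosedUp

namespace PGPS

variable {X : PGPS.{u}}

theorem adm_exists_base {U : Set X} (hU : U ∈ X.adm) {x : X} (hx : x ∉ U) :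
    ∃ y ∈ X.base, y ∉ U ∧ x ≤ y := by
  obtain ⟨y, hxy, hy⟩ := priestley_exists_maximal (K := Uᶜ) hU.1.compl.isClosed hx
  exact ⟨y, hU.2.2 y hy, hy.1, hxy⟩

theorem mem_adm_of_exists {U : Set X} (hc : IsClopen U) (hu : IsUpperSet U)
    (h : ∀ x, x ∉ U → ∃ y ∈ X.base, y ∉ U ∧ x ≤ y) : U ∈ X.adm := by
  refine ⟨hc, hu, fun x hx => ?_⟩
  obtain ⟨y, h1, h2, h3⟩ := h x hx.1
  rwa [le_antisymm h3 (hx.2 h2 h3)]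

/-- An admissible clopen upset as an admissible closed upset. -/
def admToClosed {U : Set X} (hU : U ∈ X.adm) : AdmClosedUp X :=
  AdmClosedUp.mk₁ U hU.1.isClosed hU.2.1 fun _ hx => adm_exists_base hU hx

/-- A point of `X₀` outside an admissible closed upset is separated from it by an admissible
clopen upset. -/
theorem exists_adm_of_base (C : AdmClosedUp X) {z : X} (hz : z ∈ X.base) (hzC : z ∉ C.carrier) :
    ∃ U ∈ X.adm, C.carrier ⊆ U ∧ z ∉ U := by
  obtain ⟨⟨U₀, hU₀⟩, hdir⟩ := (X.mem_base_iff z).1 hz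
  have : Nonempty (admMissing X.base z) := ⟨⟨U₀, hU₀⟩⟩
  have := C.closed.isCompact.elim_directed_cover
    (fun U : admMissing X.base z => U.1) (fun U => U.2.1.1.isOpen) ?_ ?_
  · obtain ⟨U, hU⟩ := this
    exact ⟨U.1, U.2.1, hU, U.2.2⟩
  · intro x hx
    have hxz : ¬ x ≤ z := fun h => hzC (C.upper h hx)
    rw [X.le_iff] at hxz
    push Not at hxz
    obtain ⟨U, hU, hxU, hzU⟩ := hxz
    exact Set.mem_iUnion.2 ⟨⟨U, hU, hzU⟩, hxU⟩
  · rintro ⟨U, hU⟩ ⟨V, hV⟩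
    obtain ⟨W, hW, h1, h2⟩ := hdir U hU V hV
    exact ⟨⟨W, hW⟩, h1, h2⟩

theorem exists_adm (C : AdmClosedUp X) {x : X} (hx : x ∉ C.carrier) :
    ∃ U ∈ X.adm, C.carrier ⊆ U ∧ x ∉ U := by
  obtain ⟨z, hz, hzC, hxz⟩ := C.exists_base hx
  obtain ⟨U, hU, h1, h2⟩ := exists_adm_of_base C hz hzC
  exact ⟨U, hU, h1, fun h => h2 (hU.2.1 hxz h)⟩

theorem univ_mem_adm : (Set.univ : Set X) ∈ X.adm :=
  ⟨isClopen_univ, isUpperSet_univ, fun _ hx => (hx.1 trivial).elim⟩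

theorem inter_mem_adm {U V : Set X} (hU : U ∈ X.adm) (hV : V ∈ X.adm) : U ∩ V ∈ X.adm := by
  refine mem_adm_of_exists (hU.1.inter hV.1) (hU.2.1.inter hV.2.1) fun x hx => ?_
  by_cases hxU : x ∈ U
  · obtain ⟨y, h1, h2, h3⟩ := adm_exists_base hV (fun h => hx ⟨hxU, h⟩)
    exact ⟨y, h1, fun h => h2 h.2, h3⟩
  · obtain ⟨y, h1, h2, h3⟩ := adm_exists_base hU hxU
    exact ⟨y, h1, fun h => h2 h.1, h3⟩

end PGPS

namespace AdmClosedUp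

variable {X : PGPS.{u}}

/-- The admissible closed upsets satisfy the join infinite distributive law. -/
instance : Order.Frame (AdmClosedUp X) := Order.Frame.ofMinimalAxioms
  { inf_sSup_le_iSup_inf := by
      intro A 𝒮 x hx
      by_contra hxn
      obtain ⟨y, hy, hyn, hxy⟩ := exists_base _ hxn
      have hyA : y ∉ A.carrier := fun h => hyn ((inf_le_left : A ⊓ sSup 𝒮 ≤ A) h)
      have hyS : y ∉ (sSup 𝒮).carrier := fun h => hyn ((inf_le_right : A ⊓ sSup 𝒮 ≤ sSup 𝒮) h)
      rw [mem_sSup] at hyS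
      push Not at hyS
      obtain ⟨B, hB, hyB⟩ := hyS
      obtain ⟨U, hU, hAU, hyU⟩ := PGPS.exists_adm_of_base A hy hyA
      obtain ⟨V, hV, hBV, hyV⟩ := PGPS.exists_adm_of_base B hy hyB
      obtain ⟨W, hW, hUW, hVW⟩ := ((X.mem_base_iff y).1 hy).2 U ⟨hU, hyU⟩ V ⟨hV, hyV⟩
      have h1 : PGPS.admToClosed hW.1 ≤ A ⊓ B :=
        le_inf (hAU.trans hUW) (hBV.trans hVW)
      have h2 : A ⊓ B ≤ ⨆ b ∈ 𝒮, A ⊓ b := le_iSup₂_of_le B hB le_rfl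
      have hyx : y ∈ (⨆ b ∈ 𝒮, A ⊓ b).carrier := AdmClosedUp.upper _ hxy hx
      exact hW.2 (h1 (h2 hyx)) }

theorem isCompactElement_of_adm {C : AdmClosedUp X} (hC : C.carrier ∈ X.adm) :
    IsCompactElement C := by
  rw [CompleteLattice.isCompactElement_iff_le_of_directed_sSup_le]
  intro 𝒮 hne hdir hle
  have : Nonempty 𝒮 := hne.to_subtype
  by_contra hcon
  push Not at hcon
  have : (⋂ D : 𝒮, (D.1.carrier ∩ C.carrierᶜ)).Nonempty := by
    refine IsCompact.nonempty_iInter_of_directed_nonempty_isCompact_isClosed _ ?_ ?_ ?_ ?_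
    · rintro ⟨A, hA⟩ ⟨B, hB⟩
      obtain ⟨D, hD, h1, h2⟩ := hdir A hA B hB
      exact ⟨⟨D, hD⟩, fun w hw => ⟨h1 hw.1, hw.2⟩, fun w hw => ⟨h2 hw.1, hw.2⟩⟩
    · rintro ⟨A, hA⟩
      obtain ⟨x, hx, hxn⟩ := Set.not_subset.1 (hcon A hA)
      exact ⟨x, hx, hxn⟩
    · exact fun D => (D.1.closed.inter hC.1.compl.isClosed).isCompact
    · exact fun D => D.1.closed.inter hC.1.compl.isClosed
  obtain ⟨x, hx⟩ := this
  rw [Set.mem_iInter] at hx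
  obtain ⟨D₀, hD₀⟩ := hne
  exact (hx ⟨D₀, hD₀⟩).2 (hle (mem_sSup.2 fun D hD => (hx ⟨D, hD⟩).1))

theorem eq_sSup_adm (C : AdmClosedUp X) :
    sSup {D : AdmClosedUp X | D.carrier ∈ X.adm ∧ D ≤ C} = C := by
  refine le_antisymm (sSup_le fun D hD => hD.2) fun x hx => ?_
  by_contra hxC
  obtain ⟨U, hU, h1, h2⟩ := PGPS.exists_adm C hxC
  exact h2 (mem_sSup.1 hx (PGPS.admToClosed hU) ⟨hU, h1⟩)

instance : IsCompactlyGenerated (AdmClosedUp X) where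
  exists_sSup_eq C := ⟨_, fun _ hD => isCompactElement_of_adm hD.1, eq_sSup_adm C⟩

/-- The compact elements are exactly the admissible clopen upsets. -/
theorem isCompactElement_iff {C : AdmClosedUp X} : IsCompactElement C ↔ C.carrier ∈ X.adm := by
  refine ⟨fun hC => ?_, isCompactElement_of_adm⟩
  rw [CompleteLattice.isCompactElement_iff_le_of_directed_sSup_le] at hC
  obtain ⟨D, hD, hCD⟩ := hC {D | D.carrier ∈ X.adm ∧ D ≤ C}
    ⟨PGPS.admToClosed PGPS.univ_mem_adm, PGPS.univ_mem_adm, fun _ _ => trivial⟩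
    (fun A hA B hB => ⟨PGPS.admToClosed (PGPS.inter_mem_adm hA.1 hB.1),
      ⟨PGPS.inter_mem_adm hA.1 hB.1, fun x hx => ⟨hA.2 hx, hB.2 hx⟩⟩,
      fun x hx => hx.1, fun x hx => hx.2⟩)
    (eq_sSup_adm C).ge
  rw [le_antisymm hCD hD.2]
  exact hD.1

end AdmClosedUp

/-! ### The functor `𝒱ᵃ` -/

theorem boxRel_closed_iff {X Y : PGPS.{u}} (R : GPMor X Y) (C : AdmClosedUp Y) (x : X) :
    x ∈ boxRel R.rel C.carrier ↔ ∀ U ∈ Y.adm, C.carrier ⊆ U → x ∈ boxRel R.rel U := by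
  constructor
  · intro h U _ hCU y hy
    exact hCU (h y hy)
  · intro h y hy
    by_contra hyC
    obtain ⟨U, hU, h1, h2⟩ := PGPS.exists_adm C hyC
    exact h2 (h U hU h1 y hy)

/-- `□_R C` for an admissible closed upset `C`. -/
def boxClosed {X Y : PGPS.{u}} (R : GPMor X Y) (C : AdmClosedUp Y) : AdmClosedUp X :=
  AdmClosedUp.mk₁ (boxRel R.rel C.carrier)
    (by
      have : boxRel R.rel C.carrier =
          ⋂ U : {U : Set Y // U ∈ Y.adm ∧ C.carrier ⊆ U}, boxRel R.rel U.1 := by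
        ext x
        rw [boxRel_closed_iff, Set.mem_iInter]
        exact ⟨fun h U => h U.1 U.2.1 U.2.2, fun h U hU hC => h ⟨U, hU, hC⟩⟩
      rw [this]
      exact isClosed_iInter fun U => (R.box_mem U.1 U.2.1).1.isClosed)
    (by
      intro x x' hxx' hx
      rw [boxRel_closed_iff] at hx ⊢
      exact fun U hU hC => (R.box_mem U hU).2.1 hxx' (hx U hU hC))
    (by
      intro x hx
      rw [boxRel_closed_iff] at hx
      push Not at hx
      obtain ⟨U, hU, hC, hxU⟩ := hx
      obtain ⟨y, h1, h2, h3⟩ := PGPS.adm_exists_base (R.box_mem U hU) hxU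
      exact ⟨y, h1, fun h => h2 fun z hz => hC (h z hz), h3⟩)

/-- `𝒱ᵃ(X)`: the admissible closed upsets of `X` ordered by reverse inclusion. -/
def VaObj (X : PGPS.{u}) : AlgFrmJ.{u} := ⟨AdmClosedUp X⟩

/-- `𝒱ᵃ(R) = □_R`. -/
def VaMap {X Y : PGPS.{u}} (R : GPMor X Y) : AlgFrmJHom (VaObj Y) (VaObj X) where
  toFun := boxClosed R
  map_sSup 𝒮 := by
    refine AdmClosedUp.ext (Set.ext fun x => ?_)
    refine Iff.trans ?_ AdmClosedUp.mem_sSup.symm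
    constructor
    · rintro h _ ⟨C, hC, rfl⟩ y hy
      exact AdmClosedUp.mem_sSup.1 (h y hy) C hC
    · intro h y hy
      exact AdmClosedUp.mem_sSup.2 fun C hC => h _ ⟨C, hC, rfl⟩ y hy
  map_compact C hC :=
    AdmClosedUp.isCompactElement_iff.2 (R.box_mem _ (AdmClosedUp.isCompactElement_iff.1 hC))

/-- The contravariant functor `𝒱ᵃ : PGPS → AlgFrm_J`. -/
def Va : PGPS.{u}ᵒᵖ ⥤ AlgFrmJ.{u} where
  obj X := VaObj X.unop
  map R := VaMap R.unop
  map_id X := by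
    refine AlgFrmJHom.ext (funext fun C => AdmClosedUp.ext ?_)
    exact boxRel_le (AdmClosedUp.upper C)
  map_comp {X Y Z} R S := by
    refine AlgFrmJHom.ext (funext fun C => AdmClosedUp.ext (Set.ext fun x => ?_))
    change x ∈ boxRel (GPMor.comp S.unop R.unop).rel (AdmClosedUp.carrier C) ↔
      x ∈ boxRel S.unop.rel (boxClosed R.unop C).carrier
    constructor
    · intro h y hy z hz
      exact h z fun U _ hx => hx y hy z hz
    · intro h z hz
      by_contra hzC
      obtain ⟨U, hU, h1, h2⟩ := PGPS.exists_adm C hzC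
      exact h2 (hz U hU fun y hy w hw => h1 (h y hy w hw))

/-! ### Prime and pseudoprime elements -/

/-- The way below relation `a ≪ b`. -/
def WayBelow {L : Type u} [CompleteLattice L] (a b : L) : Prop :=
  ∀ S : Set L, b ≤ sSup S → ∃ T : Set L, T.Finite ∧ T ⊆ S ∧ a ≤ sSup T

/-- A pseudoprime element: `p ≠ 1`, and `a₁ ∧ ⋯ ∧ aₙ ≪ p` implies `aᵢ ≤ p` for some `i`. -/
def PseudoPrime {L : Type u} [CompleteLattice L] (p : L) : Prop :=
  p ≠ ⊤ ∧ ∀ s : Finset L, WayBelow (s.inf id) p → ∃ a ∈ s, a ≤ p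

/-- The topology on `L` with subbasis `{↑k} ∪ {(↑l)ᶜ}`, where `k`, `l` range over the compact
elements. -/
abbrev compactTopology (L : Type u) [CompleteLattice L] : TopologicalSpace L :=
  TopologicalSpace.generateFrom
    ({U | ∃ k : L, IsCompactElement k ∧ U = Set.Ici k} ∪
      {U | ∃ l : L, IsCompactElement l ∧ U = (Set.Ici l)ᶜ})

/-- The underlying set of `𝒴(L)`: the pseudoprime elements of `L` together with `1`. -/
def YSet (L : AlgFrmJ.{u}) : Type u := {a : L // PseudoPrime a ∨ a = ⊤}

namespace YSet

variable {L : AlgFrmJ.{u}}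

instance : PartialOrder (YSet L) := inferInstanceAs (PartialOrder {a : L // PseudoPrime a ∨ a = ⊤})

instance : TopologicalSpace (YSet L) :=
  TopologicalSpace.induced (fun a => a.1) (compactTopology L)

theorem le_def {a b : YSet L} : a ≤ b ↔ a.1 ≤ b.1 := Iff.rfl

/-- `↑a ∩ Y_L`. -/
def up (a : L) : Set (YSet L) := {y | a ≤ y.1}

theorem mem_up {a : L} {y : YSet L} : y ∈ up a ↔ a ≤ y.1 := Iff.rfl

/-- The set of prime elements, as a subset of `Y_L`. -/
def primes (L : AlgFrmJ.{u}) : Set (YSet L) := {y | InfPrime y.1}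

theorem isClopen_up {k : L} (hk : IsCompactElement k) : IsClopen (up k) := by
  constructor
  · rw [← isOpen_compl_iff]
    refine ⟨(Set.Ici k)ᶜ, ?_, rfl⟩
    exact TopologicalSpace.isOpen_generateFrom_of_mem (Or.inr ⟨k, hk, rfl⟩)
  · refine ⟨Set.Ici k, ?_, rfl⟩
    exact TopologicalSpace.isOpen_generateFrom_of_mem (Or.inl ⟨k, hk, rfl⟩)

theorem isUpperSet_up (a : L) : IsUpperSet (up a) := fun _ _ h ha => le_trans ha h

theorem exists_compact {a b : L} (h : ¬ a ≤ b) : ∃ k, IsCompactElement k ∧ k ≤ a ∧ ¬ k ≤ b := by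
  by_contra hcon
  push Not at hcon
  exact h (le_iff_compact_le_imp.2 hcon)

theorem exists_prime {a b : L} (h : ¬ a ≤ b) : ∃ p : L, InfPrime p ∧ b ≤ p ∧ ¬ a ≤ p := by
  obtain ⟨k, hk, hka, hkb⟩ := exists_compact h
  rw [CompleteLattice.isCompactElement_iff_le_of_directed_sSup_le] at hk
  obtain ⟨p, hbp, hp⟩ := zorn_le_nonempty₀ {x : L | ¬ k ≤ x} (by
    intro c hc hchain y hy
    refine ⟨sSup c, fun hkc => ?_, fun z hz => le_sSup hz⟩
    obtain ⟨x, hx, hkx⟩ := hk c ⟨y, hy⟩ hchain.directedOn hkc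
    exact hc hx hkx) b hkb
  refine ⟨p, ⟨?_, ?_⟩, hbp, fun hap => hp.1 (hka.trans hap)⟩
  · intro hmax
    exact hp.1 (by rw [hmax.eq_top]; exact le_top)
  · intro x y hxy
    by_contra hcon
    push Not at hcon
    have key : ∀ z : L, ¬ z ≤ p → k ≤ p ⊔ z := by
      intro z hz
      by_contra hkz
      exact hz (le_sup_right.trans (hp.2 (y := p ⊔ z) hkz le_sup_left))
    have := le_inf (key x hcon.1) (key y hcon.2)
    rw [← sup_inf_left, sup_eq_left.2 hxy] at this
    exact hp.1 this

theorem wayBelow_of_compact {a t b : L} (ht : IsCompactElement t) (hat : a ≤ t) (htb : t ≤ b) :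
    WayBelow a b := by
  intro S hS
  rw [CompleteLattice.isCompactElement_iff_exists_le_sSup_of_le_sSup] at ht
  obtain ⟨T, hT, h⟩ := ht S (htb.trans hS)
  exact ⟨T, T.finite_toSet, hT, hat.trans (h.trans (by rw [Finset.sup_id_eq_sSup]))⟩

theorem exists_compact_of_wayBelow {a b : L} (h : WayBelow a b) :
    ∃ t, IsCompactElement t ∧ a ≤ t ∧ t ≤ b := by
  obtain ⟨T, hT, hTS, haT⟩ := h {c | IsCompactElement c ∧ c ≤ b} (sSup_compact_le_eq b).ge
  refine ⟨hT.toFinset.sup id, ?_, ?_, ?_⟩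
  · exact CompleteLattice.isCompactElement_finsetSup _ fun x hx => (hTS (hT.mem_toFinset.1 hx)).1
  · rw [Finset.sup_id_eq_sSup]; simpa using haT
  · exact Finset.sup_le fun x hx => (hTS (hT.mem_toFinset.1 hx)).2

theorem pseudoPrime_of_infPrime {p : L} (hp : InfPrime p) : PseudoPrime p := by
  refine ⟨fun h => hp.1 (h ▸ isMax_top), fun s hs => ?_⟩
  obtain ⟨t, _, h1, h2⟩ := exists_compact_of_wayBelow hs
  exact hp.finset_inf_le.1 (h1.trans h2)

/-- A prime element as a point of `Y_L`. -/
def ofPrime {p : L} (hp : InfPrime p) : YSet L := ⟨p, Or.inl (pseudoPrime_of_infPrime hp)⟩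

/-- The point `1` of `Y_L`. -/
def one (L : AlgFrmJ.{u}) : YSet L := ⟨⊤, Or.inr rfl⟩

theorem nhds_eq (y : YSet L) (F : Filter (YSet L))
    (h : ∀ k : L, IsCompactElement k → (k ≤ y.1 → up k ∈ F) ∧ (¬ k ≤ y.1 → (up k)ᶜ ∈ F)) :
    F ≤ nhds y := by
  have : nhds y = Filter.comap (fun a : YSet L => a.1) (@nhds L (compactTopology L) y.1) :=
    @nhds_induced _ _ (compactTopology L) _ _
  rw [this, compactTopology, TopologicalSpace.nhds_generateFrom]
  rw [← Filter.map_le_iff_le_comap]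
  refine le_iInf₂ fun U hU => ?_
  rw [Filter.le_principal_iff]
  rcases hU with ⟨hyU, ⟨k, hk, rfl⟩ | ⟨k, hk, rfl⟩⟩
  · exact (h k hk).1 hyU
  · exact (h k hk).2 hyU

theorem exists_finset_inf_compact (s : Finset L) (a : L) (h : ∀ b ∈ s, ¬ b ≤ a) :
    ∃ t : Finset L, (∀ k ∈ t, IsCompactElement k ∧ ¬ k ≤ a) ∧ t.inf id ≤ s.inf id := by
  classical
  induction s using Finset.induction_on with
  | empty => exact ⟨∅, by simp, le_rfl⟩
  | insert b s _ ih =>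
    obtain ⟨t, ht, hts⟩ := ih fun c hc => h c (Finset.mem_insert_of_mem hc)
    obtain ⟨k, hk, hkb, hka⟩ := exists_compact (h b (Finset.mem_insert_self b s))
    refine ⟨insert k t, ?_, ?_⟩
    · intro c hc
      rcases Finset.mem_insert.1 hc with rfl | hc
      · exact ⟨hk, hka⟩
      · exact ht c hc
    · rw [Finset.inf_insert, Finset.inf_insert]
      exact inf_le_inf hkb hts

instance : CompactSpace (YSet L) := by
  refine ⟨isCompact_iff_ultrafilter_le_nhds.2 fun F _ => ?_⟩
  set a : L := sSup {k : L | IsCompactElement k ∧ up k ∈ F} with ha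
  have hmem : ∀ k : L, IsCompactElement k → (k ≤ a ↔ up k ∈ F) := by
    intro k hk
    refine ⟨fun hka => ?_, fun h => le_sSup ⟨hk, h⟩⟩
    rw [CompleteLattice.isCompactElement_iff_exists_le_sSup_of_le_sSup] at hk
    obtain ⟨T, hT, hkT⟩ := hk _ hka
    have : (⋂ t ∈ T, up t) ∈ F := (Filter.biInter_finset_mem T).2 fun t ht => (hT ht).2
    refine Filter.mem_of_superset this fun y hy => ?_
    rw [Set.mem_iInter₂] at hy
    exact hkT.trans (Finset.sup_le fun t ht => hy t ht)
  have hmem' : ∀ k : L, IsCompactElement k → ¬ k ≤ a → (up k)ᶜ ∈ F := fun k hk hka =>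
    Ultrafilter.compl_mem_iff_notMem.2 fun h => hka ((hmem k hk).2 h)
  have haY : PseudoPrime a ∨ a = ⊤ := by
    by_cases htop : a = ⊤
    · exact Or.inr htop
    refine Or.inl ⟨htop, fun s hs => ?_⟩
    by_contra hcon
    push Not at hcon
    obtain ⟨t, hta, hst, hta'⟩ := exists_compact_of_wayBelow hs
    obtain ⟨T, hT, hTs⟩ := exists_finset_inf_compact s a hcon
    have h1 : up t ∈ F := (hmem t hta).1 hta'
    have h2 : (⋂ k ∈ T, (up k)ᶜ) ∈ F :=
      (Filter.biInter_finset_mem T).2 fun k hk => hmem' k (hT k hk).1 (hT k hk).2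
    have h3 : ∃ k, IsCompactElement k ∧ ¬ k ≤ a := by
      obtain ⟨k, hk, _, hka⟩ := exists_compact (a := (⊤ : L)) (b := a)
        (fun h => htop (top_le_iff.1 h))
      exact ⟨k, hk, hka⟩
    obtain ⟨k₀, hk₀, hk₀a⟩ := h3
    obtain ⟨y, ⟨hy1, hy2⟩, hy3⟩ := Ultrafilter.nonempty_of_mem
      (Filter.inter_mem (Filter.inter_mem h1 h2) (hmem' k₀ hk₀ hk₀a))
    rw [Set.mem_iInter₂] at hy2
    rcases y.2 with hy | hy
    · obtain ⟨k, hk, hky⟩ := hy.2 T (wayBelow_of_compact hta (hTs.trans hst) hy1)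
      exact hy2 k hk hky
    · exact hy3 (by rw [mem_up, hy]; exact le_top)
  exact ⟨⟨a, haY⟩, trivial, nhds_eq _ _ fun k hk => ⟨(hmem k hk).1, hmem' k hk⟩⟩

instance : PriestleySpace (YSet L) where
  priestley {x y} h := by
    obtain ⟨k, hk, hkx, hky⟩ := exists_compact (a := x.1) (b := y.1) h
    exact ⟨up k, isClopen_up hk, isUpperSet_up k, hkx, hky⟩

theorem up_mem_adm {k : L} (hk : IsCompactElement k) : up k ∈ admClopUp (primes L) := by
  refine ⟨isClopen_up hk, isUpperSet_up k, fun x hx => ?_⟩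
  obtain ⟨p, hp, hxp, hkp⟩ := exists_prime (a := k) (b := x.1) hx.1
  have h : x = ofPrime hp := le_antisymm hxp (hx.2 (y := ofPrime hp) hkp hxp)
  rw [h]
  exact hp

theorem exists_compact_up_subset {U : Set (YSet L)} (hU : IsClopen U) {a : L}
    (ha : up a ⊆ U) : ∃ k, IsCompactElement k ∧ k ≤ a ∧ up k ⊆ U := by
  classical
  obtain ⟨T, hT⟩ := hU.compl.isClosed.isCompact.elim_finite_subcover
    (fun k : {k : L // IsCompactElement k ∧ k ≤ a} => (up k.1)ᶜ)
    (fun k => (isClopen_up k.2.1).compl.isOpen) (by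
      intro y hy
      obtain ⟨k, hk, hka, hky⟩ := exists_compact (a := a) (b := y.1) fun h => hy (ha h)
      exact Set.mem_iUnion.2 ⟨⟨k, hk, hka⟩, hky⟩)
  refine ⟨T.sup fun k => k.1, CompleteLattice.isCompactElement_finsetSup _ fun k _ => k.2.1,
    Finset.sup_le fun k _ => k.2.2, fun y hy => ?_⟩
  by_contra hyU
  obtain ⟨k, hk, hky⟩ := Set.mem_iUnion₂.1 (hT hyU)
  exact hky (le_trans (Finset.le_sup (f := fun k : {k : L // IsCompactElement k ∧ k ≤ a} => k.1) hk) hy)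

theorem up_subset_iff {a b : L} : up a ⊆ up b ↔ b ≤ a := by
  refine ⟨fun h => ?_, fun h y hy => le_trans h hy⟩
  by_contra hba
  obtain ⟨p, hp, hap, hbp⟩ := exists_prime hba
  exact hbp (h (show ofPrime hp ∈ up a from hap))

theorem adm_iff {U : Set (YSet L)} :
    U ∈ admClopUp (primes L) ↔ ∃ k, IsCompactElement k ∧ U = up k := by
  classical
  refine ⟨fun hU => ?_, by rintro ⟨k, hk, rfl⟩; exact up_mem_adm hk⟩
  obtain ⟨T, hT⟩ := hU.1.isClosed.isCompact.elim_finite_subcover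
    (fun k : {k : L // IsCompactElement k ∧ up k ⊆ U} => up k.1)
    (fun k => (isClopen_up k.2.1).isOpen) (by
      intro y hy
      obtain ⟨k, hk, hky, hkU⟩ := exists_compact_up_subset hU.1 (a := y.1)
        fun z hz => hU.2.1 hz hy
      exact Set.mem_iUnion.2 ⟨⟨k, hk, hkU⟩, hky⟩)
  have hsub : up (T.inf fun k => k.1) ⊆ U := by
    intro q hq
    by_contra hqU
    obtain ⟨p, hqp, hp⟩ := priestley_exists_maximal (K := Uᶜ) hU.1.compl.isClosed hqU
    have hpp : InfPrime p.1 := hU.2.2 p hp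
    obtain ⟨k, _, hkp⟩ := hpp.finset_inf_le.1 (le_trans hq hqp)
    exact hp.1 (k.2.2 hkp)
  obtain ⟨k, hk, hkc, hkU⟩ := exists_compact_up_subset hU.1 hsub
  refine ⟨k, hk, Set.Subset.antisymm (fun y hy => ?_) hkU⟩
  obtain ⟨l, hl, hly⟩ := Set.mem_iUnion₂.1 (hT hy)
  exact hkc.trans (le_trans (Finset.inf_le hl) hly)

theorem mem_closure_primes (q : YSet L) (hq : q ≠ one L) : q ∈ closure (primes L) := by
  classical
  have hqp : PseudoPrime q.1 := q.2.resolve_right fun h => hq (Subtype.ext h)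
  have hex : ∀ i : Finset {k : L // IsCompactElement k ∧ k ≤ q.1} ×
      Finset {l : L // IsCompactElement l ∧ ¬ l ≤ q.1},
      ∃ p : YSet L, InfPrime p.1 ∧ (∀ k ∈ i.1, k.1 ≤ p.1) ∧ ∀ l ∈ i.2, ¬ l.1 ≤ p.1 := by
    rintro ⟨s, t⟩
    have hk : IsCompactElement (s.sup fun k => k.1) :=
      CompleteLattice.isCompactElement_finsetSup _ fun k _ => k.2.1
    have hkq : (s.sup fun k => k.1) ≤ q.1 := Finset.sup_le fun k _ => k.2.2
    have hnle : ¬ (t.image fun l => l.1).inf id ≤ s.sup fun k => k.1 := by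
      intro h
      obtain ⟨a, ha, haq⟩ := hqp.2 _ (wayBelow_of_compact hk h hkq)
      obtain ⟨l, _, rfl⟩ := Finset.mem_image.1 ha
      exact l.2.2 haq
    obtain ⟨p, hp, hkp, hlp⟩ := exists_prime hnle
    refine ⟨ofPrime hp, hp, fun k hks => ?_, fun l hl hle => hlp ?_⟩
    · exact le_trans (Finset.le_sup (f := fun k : {k : L // IsCompactElement k ∧ k ≤ q.1} => k.1)
        hks) hkp
    · exact (Finset.inf_le (f := id) (Finset.mem_image_of_mem _ hl)).trans hle
  choose p hp h1 h2 using hex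
  refine mem_closure_of_tendsto (f := p) (b := Filter.atTop) ?_
    (Filter.Eventually.of_forall fun i => hp i)
  refine nhds_eq q _ fun k hk => ⟨fun hkq => ?_, fun hkq => ?_⟩
  · rw [Filter.mem_map]
    filter_upwards [Filter.eventually_ge_atTop
      (({⟨k, hk, hkq⟩}, ∅) : Finset {k : L // IsCompactElement k ∧ k ≤ q.1} ×
      Finset {l : L // IsCompactElement l ∧ ¬ l ≤ q.1})] with i hi
    exact h1 i _ (hi.1 (Finset.mem_singleton_self _))
  · rw [Filter.mem_map]
    filter_upwards [Filter.eventually_ge_atTop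
      ((∅, {⟨k, hk, hkq⟩}) : Finset {k : L // IsCompactElement k ∧ k ≤ q.1} ×
      Finset {l : L // IsCompactElement l ∧ ¬ l ≤ q.1})] with i hi
    exact h2 i _ (hi.2 (Finset.mem_singleton_self _))

end YSet

/-! ### The functor `𝒴` -/

/-- `𝒴(L) = ⟨Y_L, τ, ≤, P(L), 1⟩`. -/
def YObj (L : AlgFrmJ.{u}) : PGPS.{u} where
  carrier := YSet L
  base := YSet.primes L
  pt := YSet.one L
  le_pt x := (le_top : x.1 ≤ ⊤)
  base_subset x hx h := hx.1 (by rw [h]; exact isMax_top)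
  base_dense q hq := YSet.mem_closure_primes q hq
  base_order_dense x hx := by
    obtain ⟨p, hp, hxp, _⟩ := YSet.exists_prime (a := (⊤ : L)) (b := x.1)
      fun h => hx (Subtype.ext (top_le_iff.1 h))
    exact ⟨YSet.ofPrime hp, hp, hxp⟩
  mem_base_iff a := by
    constructor
    · intro ha
      constructor
      · obtain ⟨k, hk, _, hka⟩ := YSet.exists_compact (a := (⊤ : L)) (b := a.1)
          fun h => ha.1 (by rw [top_le_iff.1 h]; exact isMax_top)
        exact ⟨YSet.up k, YSet.up_mem_adm hk, hka⟩
      · rintro U ⟨hU, haU⟩ V ⟨hV, haV⟩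
        obtain ⟨k, hk, rfl⟩ := YSet.adm_iff.1 hU
        obtain ⟨l, hl, rfl⟩ := YSet.adm_iff.1 hV
        obtain ⟨t, ht, htkl, hta⟩ := YSet.exists_compact (a := k ⊓ l) (b := a.1)
          fun h => (ha.2 h).elim haU haV
        exact ⟨YSet.up t, ⟨YSet.up_mem_adm ht, hta⟩,
          fun y hy => htkl.trans (inf_le_left.trans hy),
          fun y hy => htkl.trans (inf_le_right.trans hy)⟩
    · rintro ⟨⟨U, hU, haU⟩, hdir⟩
      refine ⟨fun h => ?_, fun x y hxy => ?_⟩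
      · obtain ⟨k, hk, rfl⟩ := YSet.adm_iff.1 hU
        exact haU (by rw [YSet.mem_up, h.eq_top]; exact le_top)
      · by_contra hcon
        push Not at hcon
        obtain ⟨k, hk, hkx, hka⟩ := YSet.exists_compact hcon.1
        obtain ⟨l, hl, hly, hla⟩ := YSet.exists_compact hcon.2
        obtain ⟨W, ⟨hW, haW⟩, hkW, hlW⟩ := hdir (YSet.up k) ⟨YSet.up_mem_adm hk, hka⟩
          (YSet.up l) ⟨YSet.up_mem_adm hl, hla⟩
        obtain ⟨t, ht, rfl⟩ := YSet.adm_iff.1 hW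
        exact haW (le_trans (le_inf (YSet.up_subset_iff.1 hkW) (YSet.up_subset_iff.1 hlW))
          (le_trans (inf_le_inf hkx hly) hxy))
  le_iff x y := by
    constructor
    · intro h U hU hx
      exact hU.2.1 h hx
    · intro h
      by_contra hxy
      obtain ⟨k, hk, hkx, hky⟩ := YSet.exists_compact (a := x.1) (b := y.1) hxy
      exact hky (h (YSet.up k) (YSet.up_mem_adm hk) hkx)

/-- The right adjoint of an `AlgFrm_J`-morphism. -/
def AlgFrmJHom.rightAdj {L M : AlgFrmJ.{u}} (α : AlgFrmJHom L M) (b : M) : L :=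
  sSup {a | α.toFun a ≤ b}

theorem AlgFrmJHom.gc {L M : AlgFrmJ.{u}} (α : AlgFrmJHom L M) :
    GaloisConnection α.toFun α.rightAdj := by
  have hmono : Monotone α.toFun := by
    intro a b hab
    have h := α.map_sSup {a, b}
    rw [Set.image_pair, sSup_pair, sSup_pair, sup_eq_right.2 hab] at h
    rw [h]
    exact le_sup_left
  intro a b
  refine ⟨fun h => le_sSup h, fun h => (hmono h).trans ?_⟩
  rw [AlgFrmJHom.rightAdj, α.map_sSup]
  refine sSup_le ?_
  rintro _ ⟨c, hc, rfl⟩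
  exact hc

/-- `p R_α q` iff `r(p) ≤ q`, where `r` is the right adjoint of `α`. -/
def YRel {L M : AlgFrmJ.{u}} (α : AlgFrmJHom L M) (p : YObj M) (q : YObj L) : Prop :=
  α.rightAdj p.1 ≤ q.1

theorem boxRel_YRel {L M : AlgFrmJ.{u}} (α : AlgFrmJHom L M) (k : L) :
    boxRel (YRel α) (YSet.up k) = YSet.up (α.toFun k) := by
  ext p
  constructor
  · intro h
    by_contra hp
    obtain ⟨q, hq, hpq, hkq⟩ := YSet.exists_prime (a := k) (b := α.rightAdj p.1)
      fun h' => hp ((α.gc _ _).2 h')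
    exact hkq (h (YSet.ofPrime hq) hpq)
  · intro h q hq
    exact le_trans ((α.gc _ _).1 h) hq

/-- `𝒴(α) = R_α`. -/
def YMap {L M : AlgFrmJ.{u}} (α : AlgFrmJHom L M) : GPMor (YObj M) (YObj L) where
  rel := YRel α
  sep p q h := by
    obtain ⟨k, hk, hkp, hkq⟩ := YSet.exists_compact h
    exact ⟨YSet.up k, YSet.up_mem_adm hk, fun z hz => le_trans hkp hz, hkq⟩
  box_mem U hU := by
    obtain ⟨k, hk, rfl⟩ := YSet.adm_iff.1 hU
    rw [boxRel_YRel]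
    exact YSet.up_mem_adm (α.map_compact k hk)

/-- The contravariant functor `𝒴 : AlgFrm_J → PGPS`. -/
def Yfun : AlgFrmJ.{u}ᵒᵖ ⥤ PGPS.{u} where
  obj L := YObj L.unop
  map α := YMap α.unop
  map_id L := by
    refine GPMor.ext_box fun U hU => ?_
    obtain ⟨k, hk, rfl⟩ := YSet.adm_iff.1 hU
    exact (boxRel_YRel _ k).trans (boxRel_le (X := YObj L.unop) (YSet.isUpperSet_up k)).symm
  map_comp {L M N} α β := by
    refine GPMor.ext_box fun U hU => ?_
    refine Eq.symm ((boxRel_starRel _ _ hU).trans ?_)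
    obtain ⟨k, hk, rfl⟩ := YSet.adm_iff.1 hU
    refine (congrArg (boxRel _) (boxRel_YRel β.unop k)).trans ?_
    exact (boxRel_YRel α.unop _).trans (boxRel_YRel (α ≫ β).unop k).symm

/-! ### Full faithfulness of `𝒱ᵃ` -/

/-! The functor `Va` is fully faithful, and every algebraic frame `L` is naturally isomorphic to
`Va` of its space of pseudoprimes. The two facts together give the equivalence.

Full faithfulness rests on identifying the compact elements of `𝒱ᵃ(X)` with the admissible clopen
upsets (`AdmClosedUp.isCompactElement_iff`). The separation axiom makes a generalized Priestley
morphism recoverable from its box on these sets (`GPMor.ext_box`). Conversely, a frame map `β`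
yields the relation whose value at `x` is the intersection of all admissible clopen `C` with `x ∈ β
C`. Since joins in `𝒱ᵃ(Y)` are intersections, preservation of joins is exactly what forces the box
of this relation to return `β` (`boxRel_relOfHom`). Preservation of finite meets is never needed.

The isomorphism for frames is `a ↦ ↑a ∩ Y_L`. It reflects order because primes separate elements
(`YSet.exists_prime`). It is onto because admissible closed upsets are intersections of admissible
clopen ones, and the latter are the sets `↑k ∩ Y_L` with `k` compact (`YSet.adm_iff`). Naturality is
the formula `boxRel_YRel`.

On the side of spaces, no homeomorphism between `X` and `𝒴(𝒱ᵃ(X))` is built by hand: the required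
natural isomorphism is reflected through the fully faithful functor `Va`. -/

theorem AlgFrmJHom.monotone {L M : AlgFrmJ.{u}} (α : AlgFrmJHom L M) : Monotone α.toFun :=
  α.gc.monotone_l

/-! ### Isomorphisms in `AlgFrm_J` from order isomorphisms -/

theorem IsCompactElement.map_orderIso {L M : Type*} [CompleteLattice L] [CompleteLattice M]
    (e : L ≃o M) {k : L} (hk : IsCompactElement k) : IsCompactElement (e k) := by
  rw [CompleteLattice.isCompactElement_iff_le_of_directed_sSup_le] at hk ⊢
  intro S hne hdir hle
  -- Compactness of `k` is tested on the directed family pulled back along `e.symm`.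
  obtain ⟨_, ⟨x, hx, rfl⟩, hkx⟩ := hk (e.symm '' S) (hne.image _)
    (directedOn_image.2 (hdir.mono' fun _ _ _ _ h => e.symm.monotone h))
    (by rw [sSup_image, ← e.symm.map_sSup]; exact (e.le_symm_apply).2 hle)
  exact ⟨x, hx, e.le_symm_apply.1 hkx⟩

/-- An order isomorphism of algebraic frames is an isomorphism in `AlgFrm_J`. -/
def AlgFrmJ.isoOfOrderIso {L M : AlgFrmJ.{u}} (e : L ≃o M) : L ≅ M where
  hom := ⟨e, fun S => by rw [e.map_sSup, sSup_image], fun _ hk => hk.map_orderIso e⟩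
  inv := ⟨e.symm, fun S => by rw [e.symm.map_sSup, sSup_image], fun _ hk => hk.map_orderIso e.symm⟩
  hom_inv_id := AlgFrmJHom.ext (funext e.symm_apply_apply)
  inv_hom_id := AlgFrmJHom.ext (funext e.apply_symm_apply)

/-! ### Recovering a morphism from its box operator -/

/-- The relation induced on points by a map of admissible closed upsets. -/
def relOfHom {X Y : PGPS.{u}} (β : AlgFrmJHom (VaObj Y) (VaObj X)) (x : X) (y : Y) : Prop :=
  ∀ C : AdmClosedUp Y, C.carrier ∈ Y.adm → x ∈ (β.toFun C : AdmClosedUp X).carrier → y ∈ C.carrier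

/-- The points related to `x` form the intersection of the admissible clopen `D` with `x ∈ β D`,
that is, the join of these `D`. If that intersection lies in `C`, then `C` is below the join, and
`β` carries both the inequality and the join over to `X`. -/
theorem boxRel_relOfHom {X Y : PGPS.{u}} (β : AlgFrmJHom (VaObj Y) (VaObj X))
    {C : AdmClosedUp Y} (hC : C.carrier ∈ Y.adm) :
    boxRel (relOfHom β) C.carrier = (β.toFun C : AdmClosedUp X).carrier := by
  ext x
  refine ⟨fun h => ?_, fun h y hy => hy C hC h⟩
  let 𝒮 : Set (AdmClosedUp Y) :=
    {D | D.carrier ∈ Y.adm ∧ x ∈ (β.toFun D : AdmClosedUp X).carrier}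
  -- The order is reverse inclusion and `sSup 𝒮` is the set of points related to `x`, so this is the
  -- hypothesis `h` restated.
  have hle : C ≤ sSup 𝒮 := fun y hy =>
    h y fun D hD hxD => AdmClosedUp.mem_sSup.1 hy D ⟨hD, hxD⟩
  -- The inequality `β C ≤ β (sSup 𝒮)` is an inclusion of the second set in the first, so it
  -- suffices that `x` lies in `β (sSup 𝒮)`.
  refine β.monotone hle ?_
  have hx : x ∈ (sSup (β.toFun '' 𝒮) : AdmClosedUp X).carrier := by
    refine AdmClosedUp.mem_sSup.2 ?_
    rintro _ ⟨D, hD, rfl⟩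
    exact hD.2
  exact (congrArg (fun A : AdmClosedUp X => x ∈ A.carrier) (β.map_sSup 𝒮)).mpr hx

/-- The generalized Priestley morphism induced by a map of admissible closed upsets. -/
def morOfHom {X Y : PGPS.{u}} (β : AlgFrmJHom (VaObj Y) (VaObj X)) : GPMor X Y where
  rel := relOfHom β
  sep x y h := by
    unfold relOfHom at h
    push Not at h
    obtain ⟨C, hC, hx, hy⟩ := h
    exact ⟨C.carrier, hC, fun z hz => hz C hC hx, hy⟩
  box_mem U hU := by
    rw [show U = (PGPS.admToClosed hU).carrier from rfl, boxRel_relOfHom β hU]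
    exact AdmClosedUp.isCompactElement_iff.1
      (β.map_compact _ (AdmClosedUp.isCompactElement_iff.2 hU))

/-- Morphisms of `AlgFrm_J` are determined by their values on compact elements. -/
theorem AlgFrmJHom.ext_compact {L M : AlgFrmJ.{u}} {α β : AlgFrmJHom L M}
    (h : ∀ k, IsCompactElement k → α.toFun k = β.toFun k) : α = β := by
  refine AlgFrmJHom.ext (funext fun a => ?_)
  -- Each element is the join of the compact elements below it, and both maps preserve that join.
  rw [← sSup_compact_le_eq a, α.map_sSup, β.map_sSup]
  exact congrArg sSup (Set.image_congr fun k hk => h k hk.1)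

/-- Equality of the two box operators is needed only at admissible clopen upsets, where
`GPMor.ext_box` applies. -/
instance Va_faithful : Va.{u}.Faithful where
  map_injective {X Y} R S h := by
    refine Quiver.Hom.unop_inj (GPMor.ext_box fun U hU => ?_)
    exact congrArg (fun γ : AlgFrmJHom (VaObj X.unop) (VaObj Y.unop) =>
      (γ.toFun (PGPS.admToClosed hU) : AdmClosedUp Y.unop).carrier) h

instance Va_full : Va.{u}.Full where
  map_surjective {X Y} β := by
    refine ⟨Quiver.Hom.op (X := Y.unop) (Y := X.unop) (morOfHom β),
      -- The box of the induced relation is known to agree with `β` only at admissible clopen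
      -- upsets; these are the compact elements, so agreement everywhere follows.
      AlgFrmJHom.ext_compact fun C hC => AdmClosedUp.ext ?_⟩
    exact boxRel_relOfHom β (AdmClosedUp.isCompactElement_iff.1 hC)

/-! ### The natural isomorphisms -/

namespace YSet

variable {L : AlgFrmJ.{u}}

/-- `↑a ∩ Y_L` as an admissible closed upset of `𝒴(L)`. -/
def upClosed (a : L) : AdmClosedUp (YObj L) :=
  AdmClosedUp.mk₁ (X := YObj L) (up a)
    (by
      -- Closedness comes from writing `a` as the join of the compact elements below it: each such
      -- `k` contributes a clopen set.
      have h : up a = ⋂ k : {k : L // IsCompactElement k ∧ k ≤ a}, up k.1 := by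
        ext y
        rw [Set.mem_iInter]
        exact ⟨fun h k => k.2.2.trans h,
          fun h => le_iff_compact_le_imp.2 fun k hk hka => h ⟨k, hk, hka⟩⟩
      rw [h]
      exact isClosed_iInter fun k => (isClopen_up k.2.1).isClosed)
    (isUpperSet_up a)
    (fun _ hx => by
      obtain ⟨p, hp, hxp, hap⟩ := exists_prime hx
      exact ⟨ofPrime hp, hp, hap, hxp⟩)

/-- An admissible closed upset is the intersection of the admissible clopen upsets containing it,
each of the form `up k` with `k` compact. Intersecting the sets `up k` corresponds to joining the
elements `k`, whence the witness. -/
theorem upClosed_surjective : Function.Surjective (upClosed (L := L)) := by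
  intro C
  refine ⟨sSup {k : L | IsCompactElement k ∧ C.carrier ⊆ up k},
    AdmClosedUp.ext (Set.Subset.antisymm (fun y hy => ?_) fun y hy => ?_)⟩
  · by_contra hyC
    obtain ⟨U, hU, hCU, hyU⟩ := PGPS.exists_adm C hyC
    obtain ⟨k, hk, rfl⟩ := adm_iff.1 hU
    have hkmem : k ∈ {k : L | IsCompactElement k ∧ C.carrier ⊆ up k} := ⟨hk, hCU⟩
    exact hyU (le_trans (le_sSup hkmem) hy)
  · exact sSup_le fun k hk => hk.2 hy

/-- `a ↦ ↑a ∩ Y_L` is an order isomorphism from `L` onto `𝒱ᵃ(𝒴(L))`. -/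
noncomputable def upOrderIso (L : AlgFrmJ.{u}) : L ≃o VaObj (YObj L) :=
  RelIso.ofSurjective (OrderEmbedding.ofMapLEIff (β := AdmClosedUp (YObj L)) upClosed
    -- `up` reverses inclusion, and so does the order on admissible closed upsets; the two reversals
    -- cancel.
    fun _ _ => up_subset_iff) upClosed_surjective

end YSet

/-! ### Naturality and assembly of the equivalence -/

/-- The natural isomorphism between the identity of `AlgFrm_Jᵒᵖ` and `𝒱ᵃ ∘ 𝒴`. -/
noncomputable def vaYfunIso : 𝟭 AlgFrmJ.{u}ᵒᵖ ≅ Yfun.{u} ⋙ Va.{u}.rightOp :=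
  (NatIso.ofComponents (F := Yfun.{u} ⋙ Va.{u}.rightOp) (G := 𝟭 AlgFrmJ.{u}ᵒᵖ)
    -- Passing to the opposite category reverses the isomorphism from `L` to `𝒱ᵃ(𝒴(L))`, which is
    -- why the family is built in this direction and inverted at the end.
    (fun L => (AlgFrmJ.isoOfOrderIso (YSet.upOrderIso L.unop)).op) (by
      intro L M α
      refine Quiver.Hom.unop_inj (AlgFrmJHom.ext (funext fun a => AdmClosedUp.ext ?_))
      -- The naturality square says that the box of `R_α` sends `↑a` to `↑α(a)`, which holds for
      -- every `a`, compact or not.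
      exact boxRel_YRel α.unop a)).symm

/-- The natural isomorphism between `𝒴 ∘ 𝒱ᵃ` and the identity of `PGPS`. -/
noncomputable def yfunVaIso : Va.{u}.rightOp ⋙ Yfun.{u} ≅ 𝟭 PGPS.{u} :=
  -- After composing with `Va`, both sides become isomorphic to `Va`: on the left, the frame
  -- isomorphism is applied to `𝒱ᵃ(X)`. Full faithfulness then lifts this to the spaces.
  Functor.fullyFaithfulCancelRight Va.{u}.rightOp
    (Functor.associator _ _ _ ≪≫ Functor.isoWhiskerLeft Va.{u}.rightOp vaYfunIso.symm ≪≫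
      Functor.rightUnitor _ ≪≫ (Functor.leftUnitor _).symm)

theorem mainTheorem1 :
    ∃ e : AlgFrmJ.{u}ᵒᵖ ≌ PGPS.{u}, e.functor = Yfun.{u} ∧ e.inverse = Va.{u}.rightOp :=
  -- No triangle identity has to be checked: `Equivalence.mk` corrects the unit and leaves both
  -- functors unchanged, so the two equations hold by definition.
  ⟨CategoryTheory.Equivalence.mk Yfun Va.rightOp vaYfunIso yfunVaIso, rfl, rfl⟩
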